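/- Let $N\ge1$ be an integer and let $0<p\le1$. Then the equation $$\Delta^2u=-u^{-p}\quad\text{in }\mathbb{R}^N$$ has no entire smooth solution; that is, there is no everywhere positive function $u:\mathbb{R}^N\to(0,\infty)$ of class $C^4$ such that $\Delta^2u(x)=-u(x)^{-p}$ for every $x\in\mathbb{R}^N$. -/

import Mathlib

open scoped Laplacian

/-- `u` is a classical entire solution of `Δ² u = -u^{-p}` in `ℝ^N`: a function of class `C⁴`
on all of `ℝ^N`, positive everywhere (so that the real power `u^{-p}` makes sense), which
satisfies the equation at every point. -/
structure IsEntireSmoothSolution (N : ℕ) (p : ℝ) (u : EuclideanSpace ℝ (Fin N) → ℝ) : Prop where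
  contDiff : ContDiff ℝ 4 u
  pos : ∀ x, 0 < u x
  equation : ∀ x, Δ (Δ u) x = -(u x) ^ (-p)

open MeasureTheory Filter Topology Metric
open scoped InnerProductSpace

/-! Averages against the weights `(1 - ‖x‖²)₊ ^ k` on rescaled balls satisfy a simple radial
identity (`hasDerivAt_ballMean`): the `R`-derivative of the mean of `f` is a multiple of `R` times
the mean of `Δ f` with `k` raised by one. As `Δ u` is superharmonic, the means of `u` grow at most
quadratically, and positivity of `u` forces `Δ u ≥ 0`. By Jensen, the means of `u ^ (-p)` are then
at least a constant over `1 + R²`; this needs `p ≤ 1`. Hence the means of `Δ u` decrease at least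
like a multiple of `log (1 + R²)` and become negative: a contradiction. -/

lemma hasDerivAt_max_zero_pow (n : ℕ) (t : ℝ) :
    HasDerivAt (fun s : ℝ => max s 0 ^ (n + 2)) ((n + 2) * max t 0 ^ (n + 1)) t := by
  rcases lt_trichotomy t 0 with ht | rfl | ht
  · have h0 : (fun s : ℝ => max s 0 ^ (n + 2)) =ᶠ[𝓝 t] fun _ => 0 := by
      filter_upwards [gt_mem_nhds ht] with s hs
      simp [max_eq_right hs.le]
    simpa [max_eq_right ht.le] using (hasDerivAt_const t (0 : ℝ)).congr_of_eventuallyEq h0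
  -- At the corner the function is dominated by `s ^ 2`, hence is `o(s)`.
  · have h0 : HasDerivAt (fun s : ℝ => s ^ 2) 0 0 := by simpa using hasDerivAt_pow 2 (0 : ℝ)
    rw [hasDerivAt_iff_isLittleO] at h0 ⊢
    refine Asymptotics.IsBigO.trans_isLittleO ?_ h0
    refine Asymptotics.IsBigO.of_bound 1 ?_
    filter_upwards [gt_mem_nhds (zero_lt_one' ℝ)] with s hs
    have h1 : 0 ≤ max s 0 := le_max_right _ _
    have h2 : max s 0 ≤ 1 := max_le hs.le zero_le_one
    have h3 : max s 0 ^ 2 ≤ s ^ 2 := by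
      rcases le_total s 0 with h | h
      · simp [max_eq_right h]; positivity
      · simp [max_eq_left h]
    have h4 : max s 0 ^ (n + 2) ≤ s ^ 2 :=
      (pow_le_pow_of_le_one h1 h2 (by omega)).trans h3
    simpa [abs_of_nonneg h1] using h4
  · have h0 : (fun s : ℝ => max s 0 ^ (n + 2)) =ᶠ[𝓝 t] fun s => s ^ (n + 2) := by
      filter_upwards [lt_mem_nhds ht] with s hs
      simp [max_eq_left hs.le]
    simpa [max_eq_left ht.le] using (hasDerivAt_pow (n + 2) t).congr_of_eventuallyEq h0

/-! ### Weighted ball means and their radial derivative -/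

section

variable {E : Type*} [NormedAddCommGroup E]

/-- The truncated power `(1 - ‖x‖²)₊ ^ k`, a radial weight supported in the closed unit ball. -/
noncomputable def ballWeight (k : ℕ) (x : E) : ℝ := max (1 - ‖x‖ ^ 2) 0 ^ k

lemma ballWeight_nonneg (k : ℕ) (x : E) : 0 ≤ ballWeight k x :=
  pow_nonneg (le_max_right _ _) k

lemma continuous_ballWeight (k : ℕ) : Continuous (ballWeight k : E → ℝ) := by
  unfold ballWeight
  fun_prop

lemma ballWeight_eq_zero {k : ℕ} (hk : k ≠ 0) {x : E} (hx : x ∉ closedBall (0 : E) 1) :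
    ballWeight k x = 0 := by
  have h : 1 < ‖x‖ := by simpa using hx
  have : 1 - ‖x‖ ^ 2 ≤ 0 := by nlinarith
  simp [ballWeight, max_eq_right this, hk]

variable [InnerProductSpace ℝ E]

lemma hasFDerivAt_ballWeight (k : ℕ) (x : E) :
    HasFDerivAt (ballWeight (k + 2))
      ((-(2 * (k + 2)) * ballWeight (k + 1) x) • innerSL ℝ x) x := by
  have h1 : HasFDerivAt (fun y : E => 1 - ‖y‖ ^ 2) (-(2 • innerSL ℝ x)) x :=
    (hasStrictFDerivAt_norm_sq x).hasFDerivAt.const_sub 1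
  have h2 := (hasDerivAt_max_zero_pow k (1 - ‖x‖ ^ 2)).comp_hasFDerivAt x h1
  refine h2.congr_fderiv ?_
  ext v
  simp [ballWeight]
  ring

variable [FiniteDimensional ℝ E]

lemma hasCompactSupport_ballWeight {k : ℕ} (hk : k ≠ 0) :
    HasCompactSupport (ballWeight k : E → ℝ) :=
  HasCompactSupport.intro (isCompact_closedBall 0 1) fun _ hx => ballWeight_eq_zero hk hx

lemma laplacian_apply_eq_sum_fderiv (f : E → ℝ) (x : E) :
    Δ f x = ∑ i, fderiv ℝ (fderiv ℝ f) x (stdOrthonormalBasis ℝ E i)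
      (stdOrthonormalBasis ℝ E i) := by
  rw [InnerProductSpace.laplacian_eq_iteratedFDeriv_stdOrthonormalBasis]
  simp [iteratedFDeriv_two_apply]

lemma ContDiff.contDiff_laplacian {f : E → ℝ} {n : ℕ} (hf : ContDiff ℝ (n + 2) f) :
    ContDiff ℝ n (Δ f) := by
  have h1 : ContDiff ℝ (n + 1) (fderiv ℝ f) :=
    hf.fderiv_right (by rw [add_assoc]; norm_num)
  have h2 : ContDiff ℝ n (fderiv ℝ (fderiv ℝ f)) := h1.fderiv_right le_rfl
  have h3 : Δ f = fun x => ∑ i, fderiv ℝ (fderiv ℝ f) x (stdOrthonormalBasis ℝ E i)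
      (stdOrthonormalBasis ℝ E i) := funext (laplacian_apply_eq_sum_fderiv f)
  rw [h3]
  exact ContDiff.sum fun i _ => (h2.clm_apply contDiff_const).clm_apply contDiff_const

variable [MeasurableSpace E] [BorelSpace E] (μ : Measure E) [μ.IsAddHaarMeasure]

lemma integrable_mul_ballWeight {g : E → ℝ} (hg : Continuous g) {k : ℕ} (hk : k ≠ 0) :
    Integrable (fun x => g x * ballWeight k x) μ :=
  (hg.mul (continuous_ballWeight k)).integrable_of_hasCompactSupport
    (hasCompactSupport_ballWeight hk).mul_left

lemma integral_ballWeight_pos {k : ℕ} (hk : k ≠ 0) : 0 < ∫ x, ballWeight k x ∂μ :=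
  (continuous_ballWeight k).integral_pos_of_hasCompactSupport_nonneg_nonzero (x := 0)
    (hasCompactSupport_ballWeight hk) (ballWeight_nonneg k) (by simp [ballWeight])

/-- The integral of `f` over the ball of centre `c` and radius `R`, rescaled to the unit ball and
weighted by `ballWeight k`. -/
noncomputable def ballMean (f : E → ℝ) (c : E) (k : ℕ) (R : ℝ) : ℝ :=
  ∫ x, f (c + R • x) * ballWeight k x ∂μ

omit [FiniteDimensional ℝ E] [BorelSpace E] [μ.IsAddHaarMeasure] in
lemma ballMean_zero (f : E → ℝ) (c : E) (k : ℕ) :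
    ballMean μ f c k 0 = f c * ∫ x, ballWeight k x ∂μ := by
  simp [ballMean, integral_const_mul]

omit [FiniteDimensional ℝ E] [BorelSpace E] [μ.IsAddHaarMeasure] in
lemma ballMean_nonneg {f : E → ℝ} (hf : ∀ x, 0 ≤ f x) (c : E) (k : ℕ) (R : ℝ) :
    0 ≤ ballMean μ f c k R :=
  integral_nonneg fun x => mul_nonneg (hf _) (ballWeight_nonneg k x)

lemma hasDerivAt_ballMean_fderiv {f : E → ℝ} (hf : ContDiff ℝ 1 f) (c : E) {k : ℕ} (hk : k ≠ 0)
    (R : ℝ) :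
    HasDerivAt (ballMean μ f c k) (∫ x, fderiv ℝ f (c + R • x) x * ballWeight k x ∂μ) R := by
  have hf' : Continuous (fderiv ℝ f) := hf.continuous_fderiv one_ne_zero
  have hcont : Continuous fun z : ℝ × E => fderiv ℝ f (c + z.1 • z.2) z.2 := by fun_prop
  obtain ⟨C, hC⟩ := ((isCompact_closedBall R 1).prod
    (isCompact_closedBall (0 : E) 1)).exists_bound_of_continuousOn hcont.continuousOn
  refine (hasDerivAt_integral_of_dominated_loc_of_deriv_le
    (F := fun R x => f (c + R • x) * ballWeight k x)
    (F' := fun R x => fderiv ℝ f (c + R • x) x * ballWeight k x)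
    (bound := fun x => C * ballWeight k x)
    (closedBall_mem_nhds R one_pos) ?_ ?_ ?_ ?_ ?_ ?_).2
  · refine Eventually.of_forall fun s => ?_
    exact (integrable_mul_ballWeight μ (by have := hf.continuous; fun_prop)
      hk).aestronglyMeasurable
  · exact integrable_mul_ballWeight μ (by have := hf.continuous; fun_prop) hk
  · exact (integrable_mul_ballWeight μ (by fun_prop) hk).aestronglyMeasurable
  · refine Eventually.of_forall fun x s hs => ?_
    rw [norm_mul, Real.norm_of_nonneg (ballWeight_nonneg k x)]
    by_cases hx : x ∈ closedBall (0 : E) 1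
    · exact mul_le_mul_of_nonneg_right (hC (s, x) ⟨hs, hx⟩) (ballWeight_nonneg k x)
    · simp [ballWeight_eq_zero hk hx]
  · exact integrable_mul_ballWeight μ continuous_const hk
  · refine Eventually.of_forall fun x s _ => ?_
    have h1 : HasDerivAt (fun s : ℝ => c + s • x) x s := by
      simpa using ((hasDerivAt_id s).smul_const x).const_add c
    exact (((hf.differentiable one_ne_zero _).hasFDerivAt).comp_hasDerivAt s h1).mul_const _

/-- Integration by parts in one direction against `ballWeight (k + 2)`. -/
lemma integral_fderiv_mul_inner_mul_ballWeight {f : E → ℝ} (hf : ContDiff ℝ 2 f) (c v : E)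
    (k : ℕ) (R : ℝ) :
    ∫ x, fderiv ℝ f (c + R • x) v * (⟪x, v⟫_ℝ * ballWeight (k + 1) x) ∂μ =
      R / (2 * (k + 2)) *
        ∫ x, fderiv ℝ (fderiv ℝ f) (c + R • x) v v * ballWeight (k + 2) x ∂μ := by
  have hf1 : ContDiff ℝ 1 (fderiv ℝ f) := hf.fderiv_right (by norm_num)
  have hf1c : Continuous (fderiv ℝ f) := hf1.continuous
  have hf2c : Continuous (fderiv ℝ (fderiv ℝ f)) := hf1.continuous_fderiv one_ne_zero
  have hg : ∀ x, HasFDerivAt (fun x => fderiv ℝ f (c + R • x) v)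
      (R • (fderiv ℝ (fderiv ℝ f) (c + R • x)).flip v) x := by
    intro x
    have h1 : HasFDerivAt (fun x : E => c + R • x) (R • ContinuousLinearMap.id ℝ E) x :=
      ((hasFDerivAt_id x).const_smul R).const_add c
    have h2 := ((hf1.differentiable one_ne_zero (c + R • x)).hasFDerivAt.comp x h1)
    refine (h2.clm_apply (hasFDerivAt_const v x)).congr_fderiv ?_
    ext w
    simp
  have hw : ∀ x : E, fderiv ℝ (ballWeight (k + 2)) x v =
      -(2 * (k + 2)) * (⟪x, v⟫_ℝ * ballWeight (k + 1) x) := by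
    intro x
    rw [(hasFDerivAt_ballWeight k x).fderiv]
    simp
    ring
  have hg' : ∀ x : E, fderiv ℝ (fun x => fderiv ℝ f (c + R • x) v) x v =
      R * fderiv ℝ (fderiv ℝ f) (c + R • x) v v := by
    intro x
    rw [(hg x).fderiv]
    simp
  have key := integral_mul_fderiv_eq_neg_fderiv_mul_of_integrable (μ := μ) (v := v)
    (f := fun x => fderiv ℝ f (c + R • x) v) (g := ballWeight (k + 2)) ?_ ?_ ?_
    (fun x _ => (hg x).differentiableAt)
    (fun x _ => (hasFDerivAt_ballWeight k x).differentiableAt)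
  · simp only [hw, hg'] at key
    have e1 : ∀ x : E, fderiv ℝ f (c + R • x) v *
        (-(2 * (k + 2)) * (⟪x, v⟫_ℝ * ballWeight (k + 1) x)) =
        -(2 * (k + 2)) *
          (fderiv ℝ f (c + R • x) v * (⟪x, v⟫_ℝ * ballWeight (k + 1) x)) := fun x => by ring
    simp only [e1, mul_assoc, integral_const_mul] at key
    rw [div_mul_eq_mul_div, eq_div_iff (by positivity)]
    linear_combination -key
  · simp only [hg']
    exact integrable_mul_ballWeight μ (by fun_prop) (by omega)
  · simp only [hw]
    have := integrable_mul_ballWeight μ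
      (g := fun x => fderiv ℝ f (c + R • x) v * (-(2 * (k + 2)) * ⟪x, v⟫_ℝ)) (by fun_prop)
      (k := k + 1) (by omega)
    refine this.congr (Eventually.of_forall fun x => ?_)
    simp only
    ring
  · exact integrable_mul_ballWeight μ (by fun_prop) (by omega)

/-- Differentiation in `R` produces `∇f(c + R x) · x`. Since `x` times one weight is a multiple of
the gradient of the next, integration by parts turns this into `Δ f`, with a factor `R` from the
rescaling. -/
lemma hasDerivAt_ballMean {f : E → ℝ} (hf : ContDiff ℝ 2 f) (c : E) (k : ℕ) (R : ℝ) :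
    HasDerivAt (ballMean μ f c (k + 1))
      (R / (2 * (k + 2)) * ballMean μ (Δ f) c (k + 2) R) R := by
  have hf1 : ContDiff ℝ 1 (fderiv ℝ f) := hf.fderiv_right (by norm_num)
  have hf1c : Continuous (fderiv ℝ f) := hf1.continuous
  have hf2c : Continuous (fderiv ℝ (fderiv ℝ f)) := hf1.continuous_fderiv one_ne_zero
  set b := stdOrthonormalBasis ℝ E with hb
  convert hasDerivAt_ballMean_fderiv μ (hf.of_le (by norm_num)) c (k := k + 1) (by omega) R using 1
  have e1 : ∀ x : E, fderiv ℝ f (c + R • x) x * ballWeight (k + 1) x =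
      ∑ i, fderiv ℝ f (c + R • x) (b i) * (⟪x, b i⟫_ℝ * ballWeight (k + 1) x) := by
    intro x
    have h : fderiv ℝ f (c + R • x) x =
        ∑ i, ⟪b i, x⟫_ℝ * fderiv ℝ f (c + R • x) (b i) := by
      conv_lhs => arg 2; rw [← b.sum_repr' x]
      simp only [map_sum, map_smul, smul_eq_mul]
    rw [h, Finset.sum_mul]
    refine Finset.sum_congr rfl fun i _ => ?_
    rw [real_inner_comm]
    ring
  simp only [e1]
  rw [integral_finsetSum]
  · simp only [integral_fderiv_mul_inner_mul_ballWeight μ hf]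
    rw [← Finset.mul_sum, ← integral_finsetSum]
    · simp only [ballMean, laplacian_apply_eq_sum_fderiv, Finset.sum_mul, hb]
    · intro i _
      exact integrable_mul_ballWeight μ (by fun_prop) (by omega)
  · intro i _
    simp only [← mul_assoc]
    exact integrable_mul_ballWeight μ (by fun_prop) (by omega)

end

/-- If `g' ≤ f'` on `[0, ∞)`, then `g - f` does not increase there. -/
lemma sub_le_sub_of_hasDerivAt_le {f g f' g' : ℝ → ℝ} (hf : ∀ t, HasDerivAt f (f' t) t)
    (hg : ∀ t, HasDerivAt g (g' t) t) (h : ∀ t, 0 ≤ t → g' t ≤ f' t) {R : ℝ} (hR : 0 ≤ R) :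
    g R - g 0 ≤ f R - f 0 := by
  have hd : ∀ t, HasDerivAt (fun t => g t - f t) (g' t - f' t) t := fun t => (hg t).sub (hf t)
  have hanti : AntitoneOn (fun t => g t - f t) (Set.Ici 0) := by
    refine antitoneOn_of_deriv_nonpos (convex_Ici 0)
      (fun t _ => (hd t).continuousAt.continuousWithinAt)
      (fun t _ => (hd t).differentiableAt.differentiableWithinAt) fun t ht => ?_
    rw [interior_Ici] at ht
    rw [(hd t).deriv]
    exact sub_nonpos.2 (h t (le_of_lt ht))
  have := hanti (Set.mem_Ici.2 le_rfl) (Set.mem_Ici.2 hR) hR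
  simp only at this
  linarith

/-- A convex minorant common to all `p` in `[0, 1]`, whose tangent-line inequality is pure algebra.
-/
lemma one_div_one_add_le_rpow_neg {t p : ℝ} (ht : 0 < t) (hp0 : 0 ≤ p) (hp1 : p ≤ 1) :
    1 / (1 + t) ≤ t ^ (-p) := by
  rcases le_total t 1 with h | h
  · calc 1 / (1 + t) ≤ 1 := by rw [div_le_one (by positivity)]; linarith
      _ ≤ t ^ (-p) := Real.one_le_rpow_of_pos_of_le_one_of_nonpos ht h (by linarith)
  · calc 1 / (1 + t) ≤ 1 / t := by gcongr; linarith
      _ = t ^ (-1 : ℝ) := by rw [Real.rpow_neg_one, one_div]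
      _ ≤ t ^ (-p) := Real.rpow_le_rpow_of_exponent_le h (by linarith)

/-- The tangent line of the convex function `t ↦ 1 / (1 + t)` at `m - 1` lies below
`t ↦ t ^ (-p)`. -/
lemma tangent_le_rpow_neg {t p m : ℝ} (ht : 0 < t) (hp0 : 0 ≤ p) (hp1 : p ≤ 1) (hm : 0 < m) :
    2 / m - (1 + t) / m ^ 2 ≤ t ^ (-p) := by
  refine le_trans ?_ (one_div_one_add_le_rpow_neg ht hp0 hp1)
  rw [← sub_nonneg]
  have : 1 / (1 + t) - (2 / m - (1 + t) / m ^ 2) = (m - (1 + t)) ^ 2 / ((1 + t) * m ^ 2) := by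
    field_simp
    ring
  rw [this]
  positivity

/-! ### Growth bounds, sign of the Laplacian, and the contradiction -/

section

variable {E : Type*} [NormedAddCommGroup E] [InnerProductSpace ℝ E] [FiniteDimensional ℝ E]
  [MeasurableSpace E] [BorelSpace E] (μ : Measure E) [μ.IsAddHaarMeasure]

/-- The weighted ball means of a superharmonic function do not exceed its value at the centre. -/
lemma ballMean_le_of_laplacian_nonpos {f : E → ℝ} (hf : ContDiff ℝ 2 f) (hΔ : ∀ x, Δ f x ≤ 0)
    (c : E) (k : ℕ) {R : ℝ} (hR : 0 ≤ R) :
    ballMean μ f c (k + 1) R ≤ f c * ∫ x, ballWeight (k + 1) x ∂μ := by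
  have h := sub_le_sub_of_hasDerivAt_le (fun t => hasDerivAt_const t (0 : ℝ))
    (hasDerivAt_ballMean μ hf c k) (fun t ht => ?_) hR
  · rw [ballMean_zero] at h
    linarith
  · have h0 : 0 ≤ ballMean μ (fun x => -Δ f x) c (k + 2) t :=
      ballMean_nonneg μ (fun x => neg_nonneg.2 (hΔ x)) c (k + 2) t
    have h1 : ballMean μ (Δ f) c (k + 2) t ≤ 0 := by
      simpa [ballMean, integral_neg] using h0
    exact mul_nonpos_of_nonneg_of_nonpos (by positivity) h1

/-- If `Δ f` is superharmonic, the weighted ball means of `f` grow at most like the quadratic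
polynomial determined by `f c` and `Δ f c`. -/
lemma ballMean_le_quadratic {f : E → ℝ} (hf : ContDiff ℝ 4 f) (hΔ : ∀ x, Δ (Δ f) x ≤ 0)
    (c : E) (k : ℕ) {R : ℝ} (hR : 0 ≤ R) :
    ballMean μ f c (k + 1) R ≤ f c * (∫ x, ballWeight (k + 1) x ∂μ) +
      Δ f c * (∫ x, ballWeight (k + 2) x ∂μ) / (4 * (k + 2)) * R ^ 2 := by
  have hΔf : ContDiff ℝ 2 (Δ f) := ContDiff.contDiff_laplacian (by norm_num; exact hf)
  set B := Δ f c * (∫ x, ballWeight (k + 2) x ∂μ) with hB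
  have hq : ∀ t : ℝ, HasDerivAt (fun t : ℝ => B / (4 * (k + 2)) * t ^ 2)
      (t / (2 * (k + 2)) * B) t := by
    intro t
    refine ((hasDerivAt_pow 2 t).const_mul _).congr_deriv ?_
    push_cast
    field_simp
    ring
  have h := sub_le_sub_of_hasDerivAt_le hq
    (hasDerivAt_ballMean μ (hf.of_le (by norm_num)) c k) (fun t ht => ?_) hR
  · rw [ballMean_zero, zero_pow two_ne_zero, mul_zero, sub_zero] at h
    linarith
  · exact mul_le_mul_of_nonneg_left (ballMean_le_of_laplacian_nonpos μ hΔf hΔ c (k + 1) ht)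
      (by positivity)

-- At a point where `Δ f < 0`, the quadratic upper bound on the means of `f` would tend to `-∞`.
include μ in
lemma laplacian_nonneg_of_nonneg {f : E → ℝ} (hf : ContDiff ℝ 4 f) (hf0 : ∀ x, 0 ≤ f x)
    (hΔ : ∀ x, Δ (Δ f) x ≤ 0) (c : E) : 0 ≤ Δ f c := by
  by_contra! hc
  have hw : 0 < ∫ x, ballWeight 2 x ∂μ := integral_ballWeight_pos μ two_ne_zero
  set A := f c * (∫ x, ballWeight 1 x ∂μ) with hA
  set B := Δ f c * (∫ x, ballWeight 2 x ∂μ) / (4 * 2) with hB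
  have hBneg : B < 0 := div_neg_of_neg_of_pos (mul_neg_of_neg_of_pos hc hw) (by norm_num)
  have hbound : ∀ R : ℝ, 0 ≤ R → 0 ≤ A + B * R ^ 2 := fun R hR => by
    have := (ballMean_nonneg μ hf0 c 1 R).trans (ballMean_le_quadratic μ hf hΔ c 0 hR)
    simpa [hA, hB] using this
  have hA0 : 0 ≤ A := by simpa using hbound 0 le_rfl
  -- This radius makes the quadratic equal to `-1`.
  have h := hbound (√((A + 1) / -B)) (Real.sqrt_nonneg _)
  rw [Real.sq_sqrt (div_nonneg (by linarith) (by linarith))] at h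
  have : B * ((A + 1) / -B) = -(A + 1) := by
    have := hBneg.ne
    field_simp
  linarith

/-- A weighted Jensen inequality for `t ↦ t ^ (-p)`: a bound on the mean of `u` bounds the mean of
`u ^ (-p)` from below. -/
lemma div_le_ballMean_rpow_neg {u : E → ℝ} (hu : Continuous u) (hpos : ∀ x, 0 < u x) {p : ℝ}
    (hp0 : 0 ≤ p) (hp1 : p ≤ 1) (c : E) {k : ℕ} (hk : k ≠ 0) {R m : ℝ} (hm : 0 < m)
    (h : (∫ x, ballWeight k x ∂μ) + ballMean μ u c k R ≤ m * ∫ x, ballWeight k x ∂μ) :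
    (∫ x, ballWeight k x ∂μ) / m ≤ ballMean μ (fun x => u x ^ (-p)) c k R := by
  set W := ∫ x, ballWeight k x ∂μ with hW
  have hcont : Continuous fun x => u x ^ (-p) :=
    hu.rpow_const fun x => Or.inl (hpos x).ne'
  have i1 : Integrable (fun x : E => (2 / m - 1 / m ^ 2) * ballWeight k x) μ :=
    integrable_mul_ballWeight μ continuous_const hk
  have i2 : Integrable (fun x => u (c + R • x) * ballWeight k x) μ :=
    integrable_mul_ballWeight μ (by fun_prop) hk
  have key : (2 / m - 1 / m ^ 2) * W - 1 / m ^ 2 * ballMean μ u c k R ≤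
      ballMean μ (fun x => u x ^ (-p)) c k R := by
    rw [hW, ballMean, ballMean, ← integral_const_mul, ← integral_const_mul,
      ← integral_sub i1 (i2.const_mul _)]
    refine integral_mono (i1.sub (i2.const_mul _))
      (integrable_mul_ballWeight μ (hcont.comp (by fun_prop : Continuous fun x => c + R • x)) hk)
      fun x => ?_
    have := mul_le_mul_of_nonneg_right (tangent_le_rpow_neg (hpos (c + R • x)) hp0 hp1 hm)
      (ballWeight_nonneg k x)
    refine le_trans (le_of_eq ?_) this
    simp only
    ring
  -- The mean of `1 + u` enters with a negative sign, so it may be replaced by its bound `m * W`,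
  -- leaving `2 W / m - W / m`.
  refine le_trans ?_ key
  have h2 : (W + ballMean μ u c k R) / m ^ 2 ≤ m * W / m ^ 2 := by gcongr
  have h3 : m * W / m ^ 2 = W / m := by field_simp
  have h4 : (2 / m - 1 / m ^ 2) * W - 1 / m ^ 2 * ballMean μ u c k R =
      2 * (W / m) - (W + ballMean μ u c k R) / m ^ 2 := by ring
  linarith

include μ in
lemma not_forall_bilaplacian_eq_neg_rpow {u : E → ℝ} (hu : ContDiff ℝ 4 u)
    (hpos : ∀ x, 0 < u x) {p : ℝ} (hp0 : 0 ≤ p) (hp1 : p ≤ 1) :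
    ¬ ∀ x, Δ (Δ u) x = -(u x) ^ (-p) := by
  intro heq
  have hΔu : ContDiff ℝ 2 (Δ u) := ContDiff.contDiff_laplacian (by norm_num; exact hu)
  have hΔ : ∀ x, Δ (Δ u) x ≤ 0 := fun x => by
    rw [heq]
    exact neg_nonpos.2 (Real.rpow_nonneg (hpos x).le _)
  have hv : ∀ x, 0 ≤ Δ u x := laplacian_nonneg_of_nonneg μ hu (fun x => (hpos x).le) hΔ
  have hW : 0 < ∫ x : E, ballWeight 2 x ∂μ := integral_ballWeight_pos μ two_ne_zero
  have hW3 : 0 < ∫ x : E, ballWeight 3 x ∂μ := integral_ballWeight_pos μ three_ne_zero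
  set W := ∫ x : E, ballWeight 2 x ∂μ with hWdef
  obtain ⟨M, hM, hMb⟩ : ∃ M : ℝ, 0 < M ∧ ∀ R, 0 ≤ R →
      W + ballMean μ u 0 2 R ≤ M * (1 + R ^ 2) * W := by
    set B := Δ u 0 * (∫ x, ballWeight 3 x ∂μ) / 12 with hB
    have hB0 : 0 ≤ B := by have := hv 0; positivity
    have hu0 := hpos 0
    -- Times `W`, this constant dominates both coefficients of `(W + u 0 * W) + B * R ^ 2`.
    refine ⟨1 + u 0 + B / W, by positivity, fun R hR => ?_⟩
    have h := ballMean_le_quadratic μ hu hΔ 0 1 hR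
    norm_num at h
    rw [← hWdef, ← hB] at h
    have e : (1 + u 0 + B / W) * (1 + R ^ 2) * W =
        W + u 0 * W + B * R ^ 2 + ((1 + u 0) * R ^ 2 * W + B) := by
      field_simp
      ring
    rw [e]
    have : 0 ≤ (1 + u 0) * R ^ 2 * W + B := by positivity
    linarith
  have hlower : ∀ R : ℝ, 0 ≤ R →
      ballMean μ (Δ (Δ u)) 0 2 R ≤ -(W / (M * (1 + R ^ 2))) := by
    intro R hR
    have h := div_le_ballMean_rpow_neg μ hu.continuous hpos hp0 hp1 0 two_ne_zero
      (m := M * (1 + R ^ 2)) (by positivity) (hMb R hR)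
    have e : ballMean μ (Δ (Δ u)) 0 2 R = -ballMean μ (fun x => u x ^ (-p)) 0 2 R := by
      simp only [ballMean, heq, neg_mul, integral_neg]
    rw [e]
    exact neg_le_neg h
  -- An explicit primitive of the bound on the derivative of the mean of `Δ u`, whose factor is `t /
  -- 4` at `k = 0`.
  have hlog : ∀ t : ℝ, HasDerivAt (fun t : ℝ => -(W / (8 * M)) * Real.log (1 + t ^ 2))
      (t / (2 * ((0 : ℕ) + 2)) * -(W / (M * (1 + t ^ 2)))) t := by
    intro t
    have h1 : HasDerivAt (fun t : ℝ => 1 + t ^ 2) (2 * t) t := by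
      simpa using (hasDerivAt_pow 2 t).const_add 1
    have h2 : (1 + t ^ 2 : ℝ) ≠ 0 := by positivity
    refine ((h1.log h2).const_mul _).congr_deriv ?_
    field_simp
    ring
  have hb : ∀ R : ℝ, 0 ≤ R →
      W / (8 * M) * Real.log (1 + R ^ 2) ≤ ballMean μ (Δ u) 0 1 0 := by
    intro R hR
    have h := sub_le_sub_of_hasDerivAt_le hlog (hasDerivAt_ballMean μ hΔu 0 0)
      (fun t ht => mul_le_mul_of_nonneg_left (hlower t ht) (by positivity)) hR
    have h0 := ballMean_nonneg μ hv 0 1 R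
    simp only [zero_add] at h
    norm_num at h
    linarith
  have hlim : Tendsto (fun R : ℝ => W / (8 * M) * Real.log (1 + R ^ 2)) atTop atTop :=
    (Real.tendsto_log_atTop.comp (tendsto_atTop_add_const_left _ 1
      (tendsto_pow_atTop two_ne_zero))).const_mul_atTop (by positivity)
  obtain ⟨R, hR, hR0⟩ := ((hlim.eventually_gt_atTop _).and (eventually_ge_atTop 0)).exists
  exact absurd (hb R hR0) (not_le.2 hR)

end

theorem theorem1p5 (N : ℕ) (hN : 1 ≤ N) (p : ℝ) (hp0 : 0 < p) (hp1 : p ≤ 1) :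
    ¬ ∃ u : EuclideanSpace ℝ (Fin N) → ℝ, IsEntireSmoothSolution N p u := by
  rintro ⟨u, hu⟩
  exact not_forall_bilaplacian_eq_neg_rpow volume hu.contDiff hu.pos hp0.le hp1 hu.equation
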